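/- **Setting.** Let $1\le k\le d$ be integers, $\mathcal X=\{\pm1\}^{d+1}$, where the last coordinate of $x\in\mathcal X$ is the label of the example $(x_1,\dots,x_d)$, and $\binom{d}{\le k}=\sum_{j=1}^{k}\binom dj$. A signed parity is a pair $(\ell,b)\in 2^{[d]}\times\{\pm1\}$; its width is $|\ell|$, and for a distribution $\mathbf P$ on $\mathcal X$ its error is $\mathrm{err}_{\mathbf P}(\ell,b)=\Pr_{X\sim\mathbf P}\big[b\prod_{j\in\ell}X_j\ne X_{d+1}\big]$. An online algorithm $M$ keeps a random internal state, updates it by a randomized map after each element of the stream, and at the end produces an output by a randomized map applied to the final state. On streams of length $n$ it is $(\varepsilon,\delta)$-pan-private if for all streams $\vec x,\vec x'\in\mathcal X^n$ that differ in at most one element, all times $1\le t\le n$ and all measurable sets $T$ of pairs (state, output), $$\Pr\big[(S_t(\vec x),\mathrm{Out}(\vec x))\in T\big]\le e^{\varepsilon}\Pr\big[(S_t(\vec x'),\mathrm{Out}(\vec x'))\in T\big]+\delta ,$$ where $S_t$ is the state after the first $t$ elements and $\mathrm{Out}$ is the output of the same execution. $M$ learns width-$k$ signed parities with error $\alpha$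 and sample complexity $n$ if for every distribution $\mathbf P$ on $\mathcal X$, on $n$ independent samples from $\mathbf P$, it outputs a signed parity $(L,B)$ (of any width) such that with probability at least $99/100$ over the samples and $M$, $$\mathrm{err}_{\mathbf P}(L,B)<\min_{|\ell|\le k,\;b\in\{\pm1\}}\mathrm{err}_{\mathbf P}(\ell,b)+\alpha .$$ **Theorem.** For every $\varepsilon_0>0$ there are constants $c_1,c_2>0$, depending only on $\varepsilon_0$, such that the following holds for all integers $1\le k\le d$ and $n\ge0$ and all reals $0<\alpha<\tfrac12$, $0<\varepsilon\le\varepsilon_0$, $0\le\delta\le\tfrac12$ with $$\delta\,\log\frac{\binom{d}{\le k}}{\delta}\;\le\; c_1\,\frac{\alpha^2\varepsilon^2}{\binom{d}{\le k}}$$ (the left side being $0$ for $\delta=0$). If an $(\varepsilon,\delta)$-pan-private online algorithm learns width-$k$ signed parities with error $\alpha$ and sample complexity $n$, then $$n\;\ge\; c_2\,\frac{\sqrt{\binom{d}{\le k}}}{\alpha\,\varepsilon}.$$ -/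

import Mathlib

open MeasureTheory ProbabilityTheory
open scoped ENNReal

/-- An online algorithm with data universe `X` (finite or countable, regarded as discrete),
measurable state space `S` and measurable output space `O`.  Before any element is read the
state has the law `init`; when the element with index `i` (counted from `0`) has the value `x`,
the state is updated by the Markov kernel `step i x`; after the stream the output is drawn by the
Markov kernel `out`.  A first step that has no previous state is a kernel `step 0 x`
that ignores its argument. -/
structure OnlineAlgorithm (X S O : Type*) [MeasurableSpace S] [MeasurableSpace O] where
  init : Measure S
  step : ℕ → X → Kernel S S
  out : Kernel S O
  init_prob : IsProbabilityMeasure init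
  step_markov : ∀ i x, IsMarkovKernel (step i x)
  out_markov : IsMarkovKernel out

namespace OnlineAlgorithm

variable {X S O : Type*} [MeasurableSpace S] [MeasurableSpace O]

/-- Evolution of the state while the elements of a list are read, the first of them having
index `i` in the stream. -/
noncomputable def run (M : OnlineAlgorithm X S O) : ℕ → List X → Kernel S S
  | _, [] => Kernel.id
  | i, x :: xs => (M.run (i + 1) xs) ∘ₖ (M.step i x)

/-- The law of the internal state after the stream `xs`. -/
noncomputable def stateLaw (M : OnlineAlgorithm X S O) (xs : List X) : Measure S :=
  M.init.bind (M.run 0 xs)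

/-- The law of the final output on the stream `xs`. -/
noncomputable def outputLaw (M : OnlineAlgorithm X S O) (xs : List X) : Measure O :=
  (M.stateLaw xs).bind M.out

/-- The joint law, in one execution on the stream `xs`, of the internal state after the first
`t` elements and the final output. -/
noncomputable def viewLaw (M : OnlineAlgorithm X S O) (t : ℕ) (xs : List X) : Measure (S × O) :=
  (M.stateLaw (xs.take t)) ⊗ₘ (M.out ∘ₖ M.run t (xs.drop t))

instance instRunMarkov (M : OnlineAlgorithm X S O) (i : ℕ) (xs : List X) :
    IsMarkovKernel (M.run i xs) := by
  induction xs generalizing i with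
  | nil => unfold run; infer_instance
  | cons x xs ih =>
    have := M.step_markov i x
    have := ih (i + 1)
    unfold run
    infer_instance

instance instStateProb (M : OnlineAlgorithm X S O) (xs : List X) :
    IsProbabilityMeasure (M.stateLaw xs) := by
  have := M.init_prob
  unfold stateLaw
  infer_instance

instance instOutputProb (M : OnlineAlgorithm X S O) (xs : List X) :
    IsProbabilityMeasure (M.outputLaw xs) := by
  have := M.out_markov
  unfold outputLaw
  infer_instance

instance instViewProb (M : OnlineAlgorithm X S O) (t : ℕ) (xs : List X) :
    IsProbabilityMeasure (M.viewLaw t xs) := by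
  have := M.out_markov
  unfold viewLaw
  infer_instance

/-- `(ε, δ)`-pan-privacy on streams of length `n`: for streams that differ in at most one
position and every time `t`, the pair (state at time `t`, final output) is
`(ε, δ)`-indistinguishable. -/
def PanPrivate (M : OnlineAlgorithm X S O) (n : ℕ) (ε δ : ℝ) : Prop :=
  ∀ x x' : Fin n → X, (∃ i, ∀ j, j ≠ i → x j = x' j) →
    ∀ t : ℕ, 1 ≤ t → t ≤ n → ∀ T : Set (S × O), MeasurableSet T →
      M.viewLaw t (List.ofFn x) T
        ≤ ENNReal.ofReal (Real.exp ε) * M.viewLaw t (List.ofFn x') T + ENNReal.ofReal δ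

end OnlineAlgorithm

/-- Labelled examples, the points of `{±1}^(d+1)`; the last coordinate is the label. -/
abbrev LabelledPoint (d : ℕ) : Type := Fin (d + 1) → ℤˣ

/-- A signed parity function on `{±1}^d`: a set of coordinates and a sign. -/
structure SignedParity (d : ℕ) where
  support : Finset (Fin d)
  sign : ℤˣ

instance instMeasurableSpaceSignedParity (d : ℕ) : MeasurableSpace (SignedParity d) := ⊤

namespace SignedParity

/-- The predicted label `b * ∏ j ∈ ℓ, x j`. -/
def predict {d : ℕ} (h : SignedParity d) (x : LabelledPoint d) : ℤˣ :=
  h.sign * ∏ j ∈ h.support, x j.castSucc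

/-- The probability that `h` misclassifies a random example drawn from `P`. -/
noncomputable def err {d : ℕ} (P : PMF (LabelledPoint d)) (h : SignedParity d) : ℝ :=
  ∑ x : LabelledPoint d, if h.predict x ≠ x (Fin.last d) then (P x).toReal else 0

end SignedParity

/-- `M` learns width-`k` signed parities with error `α` from `n` samples: for every distribution
`P` on `{±1}^(d+1)`, with probability at least `99/100` over `n` independent samples from `P` and
over `M`, the error of the reported hypothesis is less than `α` plus the error of each
(equivalently, of the best) signed parity of width at most `k`. The reported hypothesis may have any
width. -/
def LearnsSignedParities {d : ℕ} {S : Type*} [MeasurableSpace S]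
    (M : OnlineAlgorithm (LabelledPoint d) S (SignedParity d)) (k n : ℕ) (α : ℝ) : Prop :=
  ∀ P : PMF (LabelledPoint d),
    (99 / 100 : ℝ≥0∞) ≤ ∑ x : Fin n → LabelledPoint d, (∏ i, P (x i)) *
      M.outputLaw (List.ofFn x)
        {h | ∀ g : SignedParity d, g.support.card ≤ k → h.err P < g.err P + α}

/-- `binom(d, ≤ k) = ∑_{j=1}^k binom(d, j)`. -/
def binomLe (d k : ℕ) : ℕ := ∑ j ∈ Finset.Icc 1 k, d.choose j

/-!
For a set `l` of at most `k` coordinates let `P l` be the distribution on `{±1}^(d+1)` with density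
`1 + 2 α χ_l` with respect to the uniform distribution, where the character `χ_l` is the label times
the parity of `l` (`biasedPMF`). Only `(l, +1)` has error below `1 / 2`, so a learner run on `P l` must
output exactly this hypothesis (`LearnsSignedParities.le_streamSum`), whereas on uniform samples
the probabilities of outputting `(l, +1)` add up to at most `1` over `l`
(`sum_streamSum_uniform_le`). The number of sets `l` is `|V| = binomLe d k + 1 ≥ 2`, so for an average
`l` the learner tells `P l` from the uniform distribution with constant advantage.

Pan-privacy bounds this advantage by a hybrid argument over the streams whose first `t` elements are
uniform and whose other elements are drawn from `P l`. Consecutive hybrids differ in one element `x`;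
the prefix before it does not depend on `l`, and what follows is a test `φ l` applied to the state
after `x`. By privacy the laws `Q x` of this state, for a fixed prefix, are mutually
indistinguishable. Up to normalization, the sum over `l` of the differences of consecutive hybrids is
`2 α ∑ x, ∫ G x dQ x` with `G x s = ∑ l, χ_l x * φ l s`. Since `∑ x, G x s = 0`, only the deviation of
`Q x` from `Q 1` matters, and that is at most `(exp ε - 1) ∫ |G x| dQ 1 + 2 δ |V|`
(`integral_sub_integral_le`). By orthogonality of the characters the mean of `|G x s|` over `x` is at
most `√|V|` (`sum_abs_sum_labelParity_le`). Hence the advantage on an average `l` is at most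
`n * 2 α * ((exp ε - 1) / √|V| + 2 δ)` (`sum_streamSum_biased_le`). The hypothesis on `δ` makes the
second term of order `ε / √|V|` (`delta_le`), and the bound on `n` follows.
-/

/-! ### Weighted sums over streams -/

/-- The sum of `f` over all streams whose length is that of the list `ws` of weight functions, a
stream being weighted by the product of the weights of its elements. -/
def streamSum {X : Type*} [Fintype X] : List (X → ℝ) → (List X → ℝ) → ℝ
  | [], f => f []
  | w :: ws, f => ∑ x, w x * streamSum ws (fun l => f (x :: l))

section StreamSum

variable {X : Type*} [Fintype X]

lemma streamSum_append (ws ws' : List (X → ℝ)) (f : List X → ℝ) :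
    streamSum (ws ++ ws') f = streamSum ws (fun l => streamSum ws' (fun l' => f (l ++ l'))) := by
  induction ws generalizing f with
  | nil => simp [streamSum]
  | cons w ws ih => simp [streamSum, ih]

lemma streamSum_replicate (n : ℕ) (w : X → ℝ) (f : List X → ℝ) :
    streamSum (List.replicate n w) f =
      ∑ x : Fin n → X, (∏ i, w (x i)) * f (List.ofFn x) := by
  induction n generalizing f with
  | zero => simp [streamSum]
  | succ n ih =>
    rw [← (Fin.consEquiv fun _ => X).sum_comp, Fintype.sum_prod_type]
    simp only [List.replicate_succ, streamSum, ih, Fin.consEquiv_apply, Fin.prod_univ_succ,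
      Fin.cons_zero, Fin.cons_succ, List.ofFn_succ, Finset.mul_sum, mul_assoc]

/-- Replacing the weights `p` by `u` one element at a time, the first elements first. -/
lemma streamSum_replicate_sub (n : ℕ) (p u : X → ℝ) (f : List X → ℝ) :
    streamSum (List.replicate n p) f - streamSum (List.replicate n u) f =
      ∑ t ∈ Finset.range n, streamSum (List.replicate t u) (fun l =>
        ∑ x, (p x - u x) *
          streamSum (List.replicate (n - (t + 1)) p) (fun l' => f (l ++ x :: l'))) := by
  have key := Finset.sum_range_sub'
    (fun t => streamSum (List.replicate t u ++ List.replicate (n - t) p) f) n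
  simp only [List.replicate_zero, List.nil_append, Nat.sub_zero, Nat.sub_self,
    List.append_nil] at key
  rw [← key]
  refine Finset.sum_congr rfl fun t ht => ?_
  have h : n - t = (n - (t + 1)) + 1 := by have := Finset.mem_range.1 ht; omega
  rw [h, List.replicate_succ, List.replicate_succ', List.append_assoc, streamSum_append,
    streamSum_append, streamSum_replicate, streamSum_replicate, streamSum_replicate,
    ← Finset.sum_sub_distrib]
  refine Finset.sum_congr rfl fun x _ => ?_
  rw [← mul_sub]
  simp only [List.singleton_append, streamSum, ← Finset.sum_sub_distrib, sub_mul]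

/-- If the weights `u` are those of a probability distribution, then a bound for a sum of functions
at every stream of length `n` bounds the sum of their averages. -/
lemma sum_streamSum_replicate_le {ι : Type*} (V : Finset ι) (n : ℕ) (u : X → ℝ)
    (hu : ∀ x, 0 ≤ u x) (hu1 : ∑ x, u x = 1) (g : ι → List X → ℝ) (B : ℝ)
    (hB : ∀ l : List X, l.length = n → ∑ v ∈ V, g v l ≤ B) :
    ∑ v ∈ V, streamSum (List.replicate n u) (g v) ≤ B := by
  simp only [streamSum_replicate]
  rw [Finset.sum_comm]
  calc ∑ x : Fin n → X, ∑ v ∈ V, (∏ i, u (x i)) * g v (List.ofFn x)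
      ≤ ∑ x : Fin n → X, (∏ i, u (x i)) * B := by
        refine Finset.sum_le_sum fun x _ => ?_
        rw [← Finset.mul_sum]
        exact mul_le_mul_of_nonneg_left (hB _ (by simp)) (Finset.prod_nonneg fun i _ => hu _)
    _ = B := by
        rw [← Finset.sum_mul, ← Fintype.prod_sum (fun (_ : Fin n) x => u x)]
        simp [hu1]

end StreamSum

/-! ### Indistinguishability tested on functions -/

section Indistinguishable

variable {S : Type*} [MeasurableSpace S] {μ ν : Measure S} [IsProbabilityMeasure μ]
  [IsProbabilityMeasure ν] {a δ C : ℝ}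

lemma integrable_of_measurable_of_abs_le {F : S → ℝ} (hF : Measurable F) (h : ∀ s, |F s| ≤ C) :
    Integrable F μ :=
  .of_bound hF.aestronglyMeasurable C (.of_forall h)

/-- By the layer cake formula, `(a, δ)`-domination of events passes to bounded functions. -/
lemma integral_le_of_measure_le (ha : 0 ≤ a) (hδ : 0 ≤ δ) (hC : 0 ≤ C)
    (h : ∀ T, MeasurableSet T → μ T ≤ ENNReal.ofReal a * ν T + ENNReal.ofReal δ)
    {F : S → ℝ} (hF : Measurable F) (h0 : ∀ s, 0 ≤ F s) (h1 : ∀ s, F s ≤ C) :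
    ∫ s, F s ∂μ ≤ a * ∫ s, F s ∂ν + C * δ := by
  have hb : ∀ s, |F s| ≤ C := fun s => by rw [abs_of_nonneg (h0 s)]; exact h1 s
  have hr : ∀ T, MeasurableSet T → μ.real T ≤ a * ν.real T + δ := by
    intro T hT
    have := ENNReal.toReal_mono (by finiteness) (h T hT)
    rwa [ENNReal.toReal_add (by finiteness) (by finiteness), ENNReal.toReal_mul,
      ENNReal.toReal_ofReal ha, ENNReal.toReal_ofReal hδ] at this
  have anti : ∀ ρ : Measure S, IsProbabilityMeasure ρ →
      Antitone fun t : ℝ => ρ.real {s | t ≤ F s} := fun ρ _ t t' htt' =>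
    measureReal_mono fun s (hs : t' ≤ F s) => htt'.trans hs
  rw [(integrable_of_measurable_of_abs_le hF hb).integral_eq_integral_Ioc_meas_le (.of_forall h0)
      (.of_forall h1),
    (integrable_of_measurable_of_abs_le hF hb).integral_eq_integral_Ioc_meas_le (.of_forall h0)
      (.of_forall h1)]
  have hi : ∀ ρ : Measure S, IsProbabilityMeasure ρ →
      IntegrableOn (fun t : ℝ => ρ.real {s | t ≤ F s}) (Set.Ioc 0 C) := fun ρ hρ =>
    ((anti ρ hρ).antitoneOn _ |>.integrableOn_isCompact isCompact_Icc).mono_set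
      Set.Ioc_subset_Icc_self
  calc ∫ t in Set.Ioc 0 C, μ.real {s | t ≤ F s}
      ≤ ∫ t in Set.Ioc 0 C, (a * ν.real {s | t ≤ F s} + δ) := by
        refine setIntegral_mono (hi μ ‹_›) (((hi ν ‹_›).const_mul a).add (by simp)) fun t => ?_
        exact hr _ (measurableSet_le measurable_const hF)
    _ = a * (∫ t in Set.Ioc 0 C, ν.real {s | t ≤ F s}) + C * δ := by
        rw [integral_add ((hi ν ‹_›).const_mul a) (by simp), integral_const_mul]
        simp [hC]

/-- Signed version: the positive part of `F` is bounded by domination of `μ` by `ν`, the negative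
part by domination of `ν` by `μ`. -/
lemma integral_sub_integral_le (ha : 1 ≤ a) (hδ : 0 ≤ δ) (hC : 0 ≤ C)
    (h : ∀ T, MeasurableSet T → μ T ≤ ENNReal.ofReal a * ν T + ENNReal.ofReal δ)
    (h' : ∀ T, MeasurableSet T → ν T ≤ ENNReal.ofReal a * μ T + ENNReal.ofReal δ)
    {F : S → ℝ} (hF : Measurable F) (hb : ∀ s, |F s| ≤ C) :
    ∫ s, F s ∂μ - ∫ s, F s ∂ν ≤ (a - 1) * ∫ s, |F s| ∂ν + 2 * C * δ := by
  have mp : Measurable fun s => max (F s) 0 := hF.max measurable_const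
  have mn : Measurable fun s => max (-F s) 0 := hF.neg.max measurable_const
  have bp : ∀ s, max (F s) 0 ≤ C := fun s => max_le ((le_abs_self _).trans (hb s)) hC
  have bn : ∀ s, max (-F s) 0 ≤ C := fun s => max_le ((neg_le_abs _).trans (hb s)) hC
  have ip : ∀ ρ : Measure S, IsProbabilityMeasure ρ → Integrable (fun s => max (F s) 0) ρ :=
    fun ρ _ => integrable_of_measurable_of_abs_le (C := C) mp fun s => by
      rw [abs_of_nonneg (le_max_right _ _)]; exact bp s
  have in' : ∀ ρ : Measure S, IsProbabilityMeasure ρ → Integrable (fun s => max (-F s) 0) ρ :=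
    fun ρ _ => integrable_of_measurable_of_abs_le (C := C) mn fun s => by
      rw [abs_of_nonneg (le_max_right _ _)]; exact bn s
  have split : ∀ ρ : Measure S, IsProbabilityMeasure ρ →
      ∫ s, F s ∂ρ = ∫ s, max (F s) 0 ∂ρ - ∫ s, max (-F s) 0 ∂ρ := fun ρ hρ => by
    rw [← integral_sub (ip ρ hρ) (in' ρ hρ)]
    refine integral_congr_ae (.of_forall fun s => ?_)
    rcases le_total (F s) 0 with h | h <;> simp [h]
  have habs : ∫ s, |F s| ∂ν = ∫ s, max (F s) 0 ∂ν + ∫ s, max (-F s) 0 ∂ν := by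
    rw [← integral_add (ip ν ‹_›) (in' ν ‹_›)]
    refine integral_congr_ae (.of_forall fun s => ?_)
    rcases le_total (F s) 0 with h | h <;> simp [h, abs_of_nonneg, abs_of_nonpos]
  have h1 := integral_le_of_measure_le (zero_le_one.trans ha) hδ hC h mp
    (fun s => le_max_right _ _) bp
  have h2 := integral_le_of_measure_le (zero_le_one.trans ha) hδ hC h' mn
    (fun s => le_max_right _ _) bn
  have n2 : 0 ≤ ∫ s, max (-F s) 0 ∂ν := integral_nonneg fun s => le_max_right _ _
  rw [split μ ‹_›, split ν ‹_›, habs]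
  have hCδ := mul_nonneg hC hδ
  -- If the integral of the negative part drops from `ν` to `μ`, then the drop is at most `a - 1` times
  -- the integral for `μ`, up to `C * δ`, and that integral is at most the one for `ν`.
  rcases le_total (∫ s, max (-F s) 0 ∂ν) (∫ s, max (-F s) 0 ∂μ) with hc | hc
  · nlinarith
  · nlinarith [mul_nonneg (sub_nonneg.2 ha) (sub_nonneg.2 hc)]

end Indistinguishable

/-! ### Runs of an online algorithm -/

namespace OnlineAlgorithm

variable {X S O : Type*} [MeasurableSpace S] [MeasurableSpace O] (M : OnlineAlgorithm X S O)

lemma run_append (i : ℕ) (l l' : List X) :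
    M.run i (l ++ l') = M.run (i + l.length) l' ∘ₖ M.run i l := by
  induction l generalizing i with
  | nil => simp [run]
  | cons x l ih =>
    simp only [List.cons_append, run, ih, List.length_cons, Kernel.comp_assoc]
    congr 2
    omega

/-- The output law splits at the state reached after a prefix of the stream. -/
lemma outputLaw_append_real (l l' : List X) {A : Set O} (hA : MeasurableSet A) :
    (M.outputLaw (l ++ l')).real A =
      ∫ s, ((M.out ∘ₖ M.run l.length l') s).real A ∂(M.stateLaw l) := by
  have := M.out_markov
  have hk := Kernel.measurable_coe (M.out ∘ₖ M.run l.length l') hA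
  have h : M.outputLaw (l ++ l') = (M.out ∘ₖ M.run l.length l') ∘ₘ M.stateLaw l := by
    unfold outputLaw stateLaw
    rw [run_append, Nat.zero_add, ← Measure.comp_assoc, ← Measure.comp_assoc]
  rw [h, measureReal_def, Measure.bind_apply hA (Kernel.aemeasurable _)]
  simp only [measureReal_def]
  rw [integral_toReal hk.aemeasurable (.of_forall fun s => by finiteness)]

/-- Pan-privacy makes the state after a prefix insensitive to the last element of the prefix. -/
lemma PanPrivate.stateLaw_le {M : OnlineAlgorithm X S O} {n : ℕ} {ε δ : ℝ}
    (h : M.PanPrivate n ε δ) (l : List X) (hl : l.length < n) (x x' : X) {T : Set S}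
    (hT : MeasurableSet T) :
    M.stateLaw (l ++ [x]) T ≤
      ENNReal.ofReal (Real.exp ε) * M.stateLaw (l ++ [x']) T + ENNReal.ofReal δ := by
  have := M.out_markov
  -- The elements after the prefix are irrelevant; they are filled up by copies of `x`.
  let y : X → Fin n → X := fun z j => (l ++ z :: List.replicate n x).getD j x
  have hy : ∀ z, (List.ofFn (y z)).take (l.length + 1) = l ++ [z] := by
    intro z
    apply List.ext_getElem
    · simp; omega
    · intro j h1 h2
      simp only [List.length_append, List.length_singleton] at h2
      simp only [List.getElem_take, List.getElem_ofFn, y]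
      rw [List.getD_eq_getElem _ _ (by simp; omega)]
      rcases Nat.lt_or_ge j l.length with hj | hj
      · simp [hj]
      · obtain rfl : j = l.length := by omega
        simp
  have key := h (y x) (y x') ⟨⟨l.length, hl⟩, fun j hj => ?_⟩ (l.length + 1) (by omega) (by omega)
    (Prod.fst ⁻¹' T) (measurable_fst hT)
  · have hv : ∀ z, M.viewLaw (l.length + 1) (List.ofFn (y z)) (Prod.fst ⁻¹' T) =
        M.stateLaw (l ++ [z]) T := fun z => by
      rw [← Measure.fst_apply hT, viewLaw, Measure.fst_compProd, hy]
    rwa [hv, hv] at key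
  · have hj' : (j : ℕ) ≠ l.length := fun h => hj (Fin.ext h)
    simp only [y, List.getD_eq_getElem?_getD]
    rcases Nat.lt_or_ge j l.length with hlt | hge
    · rw [List.getElem?_append_left hlt, List.getElem?_append_left hlt]
    · obtain ⟨m, hm⟩ : ∃ m, (j : ℕ) - l.length = m + 1 := ⟨j - l.length - 1, by omega⟩
      rw [List.getElem?_append_right hge, List.getElem?_append_right hge, hm]
      simp

end OnlineAlgorithm

/-! ### Parity characters and biased distributions -/

section Parity

variable {d : ℕ}

/-- The character of `{±1}^(d+1)` that multiplies the label by the parity of the coordinates in `l`,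
with values in `ℝ`. It is `1` exactly where the parity predicts the label. -/
noncomputable def labelParity (l : Finset (Fin d)) : LabelledPoint d →* ℝ where
  toFun x := (((x (Fin.last d) * ∏ j ∈ l, x j.castSucc : ℤˣ) : ℤ) : ℝ)
  map_one' := by simp
  map_mul' x y := by
    simp only [Pi.mul_apply, Finset.prod_mul_distrib]
    push_cast
    ring

lemma units_real_eq (u : ℤˣ) : (((u : ℤˣ) : ℤ) : ℝ) = 1 ∨ (((u : ℤˣ) : ℤ) : ℝ) = -1 := by
  rcases Int.units_eq_one_or u with rfl | rfl <;> simp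

lemma labelParity_eq (l : Finset (Fin d)) (x : LabelledPoint d) :
    labelParity l x = 1 ∨ labelParity l x = -1 := units_real_eq _

lemma abs_labelParity (l : Finset (Fin d)) (x : LabelledPoint d) : |labelParity l x| = 1 := by
  rcases labelParity_eq l x with h | h <;> simp [h]

lemma card_labelledPoint : (Fintype.card (LabelledPoint d) : ℝ) = 2 ^ (d + 1) := by
  simp [LabelledPoint]

lemma sum_labelParity (l : Finset (Fin d)) : ∑ x, labelParity l x = 0 := by
  refine sum_hom_units_eq_zero _ fun h => ?_
  have := DFunLike.congr_fun h (Pi.mulSingle (Fin.last d) (-1))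
  norm_num [labelParity, Pi.mulSingle_apply, Fin.castSucc_ne_last] at this

/-- Flipping the coordinate `j` changes the sign of `labelParity l` exactly if `j ∈ l`. -/
lemma labelParity_mulSingle (l : Finset (Fin d)) (j : Fin d) :
    labelParity l (Pi.mulSingle j.castSucc (-1)) = if j ∈ l then -1 else 1 := by
  have : ∀ i : Fin d, (Pi.mulSingle j.castSucc (-1) : LabelledPoint d) i.castSucc =
      if i = j then -1 else 1 := fun i => by simp [Pi.mulSingle_apply]
  simp only [labelParity, MonoidHom.coe_mk, OneHom.coe_mk, this, Finset.prod_ite_eq']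
  split_ifs <;> simp [(Fin.castSucc_ne_last j).symm]

lemma sum_labelParity_mul (l l' : Finset (Fin d)) :
    ∑ x, labelParity l x * labelParity l' x = if l = l' then 2 ^ (d + 1) else 0 := by
  split_ifs with h
  · subst h
    have : ∀ x, labelParity l x * labelParity l x = 1 := fun x => by
      rcases labelParity_eq l x with h | h <;> simp [h]
    simp [this]
  · refine sum_hom_units_eq_zero (labelParity l * labelParity l') fun heq => h ?_
    ext j
    have := DFunLike.congr_fun heq (Pi.mulSingle j.castSucc (-1))
    rw [MonoidHom.mul_apply, labelParity_mulSingle, labelParity_mulSingle] at this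
    split_ifs at this with h1 h2 h2
    · exact iff_of_true h1 h2
    · norm_num at this
    · norm_num at this
    · exact iff_of_false h1 h2

/-- The probability of `x` under the distribution in which all coordinates but the label are uniform
and, given these, the parity of `l` predicts the label with probability `(1 + β) / 2`. -/
noncomputable def biasedWeight (β : ℝ) (l : Finset (Fin d)) (x : LabelledPoint d) : ℝ :=
  (1 + β * labelParity l x) / 2 ^ (d + 1)

variable {β : ℝ}

lemma biasedWeight_nonneg (h0 : 0 ≤ β) (h1 : β ≤ 1) (l : Finset (Fin d)) (x : LabelledPoint d) :
    0 ≤ biasedWeight β l x := by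
  refine div_nonneg ?_ (by positivity)
  rcases labelParity_eq l x with h | h <;> rw [h] <;> linarith

lemma sum_biasedWeight (l : Finset (Fin d)) : ∑ x, biasedWeight β l x = 1 := by
  simp only [biasedWeight, ← Finset.sum_div, Finset.sum_add_distrib, ← Finset.mul_sum,
    sum_labelParity]
  simp

/-- The distribution with the weights `biasedWeight β l`. -/
noncomputable def biasedPMF (h0 : 0 ≤ β) (h1 : β ≤ 1) (l : Finset (Fin d)) :
    PMF (LabelledPoint d) :=
  PMF.ofFintype (fun x => ENNReal.ofReal (biasedWeight β l x)) (by
    rw [← ENNReal.ofReal_sum_of_nonneg fun x _ => biasedWeight_nonneg h0 h1 l x,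
      sum_biasedWeight, ENNReal.ofReal_one])

lemma biasedPMF_toReal (h0 : 0 ≤ β) (h1 : β ≤ 1) (l : Finset (Fin d)) (x : LabelledPoint d) :
    (biasedPMF h0 h1 l x).toReal = biasedWeight β l x := by
  simp [biasedPMF, biasedWeight_nonneg h0 h1 l x]

lemma err_biasedPMF (h0 : 0 ≤ β) (h1 : β ≤ 1) (l : Finset (Fin d)) (h : SignedParity d) :
    h.err (biasedPMF h0 h1 l) =
      (1 - if l = h.support then ((h.sign : ℤ) : ℝ) * β else 0) / 2 := by
  have key : ∀ x : LabelledPoint d,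
      (if h.predict x ≠ x (Fin.last d) then (biasedPMF h0 h1 l x).toReal else 0) =
        (1 + β * labelParity l x - ((h.sign : ℤ) : ℝ) * labelParity h.support x
          - ((h.sign : ℤ) : ℝ) * β * (labelParity l x * labelParity h.support x))
            / 2 ^ (d + 1) / 2 := by
    intro x
    have hx : (if h.predict x ≠ x (Fin.last d) then (1 : ℝ) else 0) =
        (1 - ((h.sign : ℤ) : ℝ) * labelParity h.support x) / 2 := by
      have units : ∀ a b c : ℤˣ, (if a * b ≠ c then (1 : ℝ) else 0) =
          (1 - ((a : ℤ) : ℝ) * (((c * b : ℤˣ) : ℤ) : ℝ)) / 2 := fun a b c => by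
        rcases Int.units_eq_one_or a with rfl | rfl <;>
          rcases Int.units_eq_one_or b with rfl | rfl <;>
          rcases Int.units_eq_one_or c with rfl | rfl <;>
          norm_num
      exact units _ _ _
    rw [← mul_one (biasedPMF h0 h1 l x).toReal, ← mul_ite_zero, hx, biasedPMF_toReal, biasedWeight]
    ring
  simp only [SignedParity.err, key, ← Finset.sum_div, Finset.sum_sub_distrib,
    Finset.sum_add_distrib, ← Finset.mul_sum, sum_labelParity, sum_labelParity_mul]
  split_ifs <;> simp
  field_simp

/-- With advantage `2 * α`, error below the optimum plus `α` means error below `1 / 2`, which only the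
planted parity with its correct sign achieves. -/
lemma eq_of_err_lt {α : ℝ} (h0 : 0 ≤ 2 * α) (h1 : 2 * α ≤ 1) (l : Finset (Fin d))
    (h : SignedParity d)
    (hh : h.err (biasedPMF h0 h1 l) < SignedParity.err (biasedPMF h0 h1 l) ⟨l, 1⟩ + α) :
    h = ⟨l, 1⟩ := by
  rw [err_biasedPMF, err_biasedPMF] at hh
  obtain ⟨s, b⟩ := h
  by_cases hs : l = s
  · rcases Int.units_eq_one_or b with rfl | rfl
    · rw [hs]
    · simp [hs] at hh; linarith
  · simp [hs] at hh; linarith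

/-- Bessel's inequality for the parity characters, in the mean over the cube. -/
lemma sum_abs_sum_labelParity_le (V : Finset (Finset (Fin d))) (c : Finset (Fin d) → ℝ)
    (hc : ∀ l, |c l| ≤ 1) :
    ∑ x, |∑ l ∈ V, labelParity l x * c l| ≤ 2 ^ (d + 1) * √(V.card : ℝ) := by
  have hsq : ∑ x, |∑ l ∈ V, labelParity l x * c l| ^ 2 ≤ 2 ^ (d + 1) * (V.card : ℝ) := by
    calc ∑ x, |∑ l ∈ V, labelParity l x * c l| ^ 2
        = ∑ l ∈ V, ∑ l' ∈ V, c l * c l' * ∑ x, labelParity l x * labelParity l' x := by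
          have hx : ∀ x, |∑ l ∈ V, labelParity l x * c l| ^ 2 =
              ∑ l ∈ V, ∑ l' ∈ V, c l * c l' * (labelParity l x * labelParity l' x) := fun x => by
            rw [sq_abs, sq, Finset.sum_mul_sum]
            exact Finset.sum_congr rfl fun l _ => Finset.sum_congr rfl fun l' _ => by ring
          simp only [hx, Finset.mul_sum]
          rw [Finset.sum_comm]
          exact Finset.sum_congr rfl fun l _ => Finset.sum_comm
      _ = ∑ l ∈ V, c l ^ 2 * 2 ^ (d + 1) := by
          refine Finset.sum_congr rfl fun l hl => ?_
          simp [sum_labelParity_mul, hl, sq]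
      _ ≤ ∑ l ∈ V, 2 ^ (d + 1) := by
          refine Finset.sum_le_sum fun l _ => mul_le_of_le_one_left (by positivity) ?_
          exact (sq_le_one_iff_abs_le_one _).2 (hc l)
      _ = 2 ^ (d + 1) * (V.card : ℝ) := by simp [mul_comm]
  have hcs := sq_sum_le_card_mul_sum_sq (s := Finset.univ)
    (f := fun x : LabelledPoint d => |∑ l ∈ V, labelParity l x * c l|)
  rw [Finset.card_univ, card_labelledPoint] at hcs
  refine abs_le_of_sq_le_sq' ?_ (by positivity) |>.2
  rw [mul_pow, Real.sq_sqrt (by positivity)]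
  calc _ ≤ _ := hcs
    _ ≤ 2 ^ (d + 1) * (2 ^ (d + 1) * (V.card : ℝ)) := by gcongr
    _ = _ := by ring

end Parity

/-! ### The effect of one biased element -/

/-- If the laws `Q x` of the state are mutually indistinguishable, then replacing one uniform element
by a biased one changes the acceptance probabilities of the tests `φ l` by little, in sum over the
planted parities `l`. All `Q x` are compared with the one law `Q 1`, for which there is no change
since characters have mean zero. -/
lemma sum_biasedWeight_sub_mul_integral_le {d : ℕ} {S : Type*} [MeasurableSpace S]
    (Q : LabelledPoint d → Measure S) (hQ1 : ∀ x, IsProbabilityMeasure (Q x)) {a δ β : ℝ}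
    (ha : 1 ≤ a) (hδ : 0 ≤ δ) (hβ : 0 ≤ β)
    (hQ : ∀ x x' T, MeasurableSet T →
      Q x T ≤ ENNReal.ofReal a * Q x' T + ENNReal.ofReal δ)
    (V : Finset (Finset (Fin d))) (φ : Finset (Fin d) → S → ℝ) (hφ : ∀ l, Measurable (φ l))
    (h1 : ∀ l s, |φ l s| ≤ 1) :
    ∑ l ∈ V, ∑ x, (biasedWeight β l x - 1 / 2 ^ (d + 1)) * ∫ s, φ l s ∂(Q x) ≤
      β * ((a - 1) * √(V.card : ℝ) + 2 * V.card * δ) := by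
  have hi : ∀ (x y) (l : Finset (Fin d)), Integrable (fun s => labelParity l x * φ l s) (Q y) :=
    fun x y l => (integrable_of_measurable_of_abs_le (hφ l) (h1 l)).const_mul _
  let G : LabelledPoint d → S → ℝ := fun x s => ∑ l ∈ V, labelParity l x * φ l s
  have hG : ∀ x, Measurable (G x) := fun x =>
    Finset.measurable_sum _ fun l _ => (hφ l).const_mul _
  have hGb : ∀ x s, |G x s| ≤ V.card := fun x s => by
    refine (Finset.abs_sum_le_sum_abs _ _).trans ?_
    refine (Finset.sum_le_sum (g := fun _ => 1) fun l _ => ?_).trans (by simp)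
    rw [abs_mul, abs_labelParity, one_mul]
    exact h1 l s
  have hGi : ∀ x y, ∫ s, G x s ∂(Q y) = ∑ l ∈ V, labelParity l x * ∫ s, φ l s ∂(Q y) := by
    intro x y
    simp only [G]
    rw [integral_finsetSum _ fun l _ => hi x y l]
    simp only [integral_const_mul]
  have hGabs : ∀ x, Integrable (fun s => |G x s|) (Q 1) := fun x =>
    (integrable_of_measurable_of_abs_le (hG x) (hGb x)).abs
  have hzero : ∑ x, ∫ s, G x s ∂(Q 1) = 0 := by
    simp only [hGi]
    rw [Finset.sum_comm]
    simp only [← Finset.sum_mul, sum_labelParity, zero_mul, Finset.sum_const_zero]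
  have hbessel : ∑ x, ∫ s, |G x s| ∂(Q 1) ≤ 2 ^ (d + 1) * √(V.card : ℝ) := by
    rw [← integral_finsetSum _ fun x _ => hGabs x]
    refine (integral_mono (integrable_finsetSum _ fun x _ => hGabs x)
      (integrable_const (2 ^ (d + 1) * √(V.card : ℝ))) fun s => ?_).trans (by simp)
    exact sum_abs_sum_labelParity_le V (fun l => φ l s) fun l => h1 l s
  have hsum : ∑ x, ∫ s, G x s ∂(Q x) ≤
      2 ^ (d + 1) * ((a - 1) * √(V.card : ℝ) + 2 * V.card * δ) := by
    calc ∑ x, ∫ s, G x s ∂(Q x) = ∑ x, (∫ s, G x s ∂(Q x) - ∫ s, G x s ∂(Q 1)) := by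
          rw [Finset.sum_sub_distrib, hzero, sub_zero]
      _ ≤ ∑ x, ((a - 1) * ∫ s, |G x s| ∂(Q 1) + 2 * V.card * δ) :=
          Finset.sum_le_sum fun x _ => integral_sub_integral_le ha hδ (by positivity) (hQ x 1)
            (hQ 1 x) (hG x) (hGb x)
      _ = (a - 1) * ∑ x, ∫ s, |G x s| ∂(Q 1) + 2 ^ (d + 1) * (2 * V.card * δ) := by
          rw [Finset.sum_add_distrib, ← Finset.mul_sum, Finset.sum_const, nsmul_eq_mul,
            Finset.card_univ, card_labelledPoint]
      _ ≤ (a - 1) * (2 ^ (d + 1) * √(V.card : ℝ)) + 2 ^ (d + 1) * (2 * V.card * δ) := by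
          gcongr
      _ = _ := by ring
  calc ∑ l ∈ V, ∑ x, (biasedWeight β l x - 1 / 2 ^ (d + 1)) * ∫ s, φ l s ∂(Q x)
      = β / 2 ^ (d + 1) * ∑ x, ∫ s, G x s ∂(Q x) := by
        rw [Finset.sum_comm]
        simp only [hGi, Finset.mul_sum, biasedWeight]
        refine Finset.sum_congr rfl fun x _ => Finset.sum_congr rfl fun l _ => ?_
        ring
    _ ≤ β / 2 ^ (d + 1) * (2 ^ (d + 1) * ((a - 1) * √(V.card : ℝ) + 2 * V.card * δ)) := by
        gcongr
    _ = _ := by field_simp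

/-! ### Learning from biased and from uniform samples -/

section Learning

variable {d : ℕ} {S : Type*} [MeasurableSpace S]
  {M : OnlineAlgorithm (LabelledPoint d) S (SignedParity d)}

/-- The average over suffixes of the acceptance probabilities from a given state is a legitimate test
`φ l` in `sum_biasedWeight_sub_mul_integral_le`; summing over the position of the replaced element
gives the distance between all-biased and all-uniform streams. -/
lemma sum_streamSum_biased_le {n : ℕ} {ε δ β : ℝ} (hM : M.PanPrivate n ε δ) (hε : 0 ≤ ε)
    (hδ : 0 ≤ δ) (hβ : 0 ≤ β) (hβ1 : β ≤ 1) (V : Finset (Finset (Fin d)))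
    (A : Finset (Fin d) → Set (SignedParity d)) :
    ∑ l ∈ V, streamSum (List.replicate n (biasedWeight β l)) (fun xs => (M.outputLaw xs).real (A l))
      ≤ ∑ l ∈ V, streamSum (List.replicate n fun _ => 1 / 2 ^ (d + 1))
          (fun xs => (M.outputLaw xs).real (A l))
        + n * (β * ((Real.exp ε - 1) * √(V.card : ℝ) + 2 * V.card * δ)) := by
  rw [← sub_le_iff_le_add', ← Finset.sum_sub_distrib]
  simp only [streamSum_replicate_sub]
  rw [Finset.sum_comm]
  refine (Finset.sum_le_card_nsmul _ _
    (β * ((Real.exp ε - 1) * √(V.card : ℝ) + 2 * V.card * δ)) fun t ht => ?_).trans (by simp)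
  refine sum_streamSum_replicate_le V t _ (fun _ => by positivity) ?_ _ _ fun w hw => ?_
  · rw [Finset.sum_const, nsmul_eq_mul, Finset.card_univ, card_labelledPoint]
    field_simp
  have := M.out_markov
  set m := n - (t + 1)
  -- The probability that the output lies in `A l` if the state is `s` and `m` biased elements follow.
  let φ : Finset (Fin d) → S → ℝ := fun l s => ∑ y : Fin m → LabelledPoint d,
    (∏ i, biasedWeight β l (y i)) *
      ((M.out ∘ₖ M.run (w.length + 1) (List.ofFn y)) s).real (A l)
  have hA : ∀ l, MeasurableSet (A l) := fun _ => trivial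
  have hmeas : ∀ l (y : List (LabelledPoint d)), Measurable fun s =>
      ((M.out ∘ₖ M.run (w.length + 1) y) s).real (A l) := fun l y =>
    (Kernel.measurable_coe _ (hA l)).ennreal_toReal
  have hφ : ∀ l, Measurable (φ l) := fun l =>
    Finset.measurable_sum _ fun y _ => (hmeas l _).const_mul _
  have hprod : ∀ l (y : Fin m → LabelledPoint d), 0 ≤ ∏ i, biasedWeight β l (y i) := fun l y =>
    Finset.prod_nonneg fun i _ => biasedWeight_nonneg hβ hβ1 _ _
  have hφ1 : ∀ l s, |φ l s| ≤ 1 := fun l s => by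
    rw [abs_of_nonneg (Finset.sum_nonneg fun y _ => mul_nonneg (hprod l y) measureReal_nonneg)]
    refine (Finset.sum_le_sum fun y _ =>
      mul_le_of_le_one_right (hprod l y) measureReal_le_one).trans ?_
    rw [← Fintype.prod_sum (fun (_ : Fin m) x => biasedWeight β l x)]
    simp [sum_biasedWeight]
  have hsuffix : ∀ l x, streamSum (List.replicate m (biasedWeight β l))
      (fun l' => (M.outputLaw (w ++ x :: l')).real (A l)) =
        ∫ s, φ l s ∂(M.stateLaw (w ++ [x])) := by
    intro l x
    simp only [φ]
    rw [streamSum_replicate, integral_finsetSum]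
    · refine Finset.sum_congr rfl fun y _ => ?_
      rw [integral_const_mul, ← List.singleton_append, ← List.append_assoc,
        M.outputLaw_append_real _ _ (hA l)]
      simp
    · intro y _
      refine (integrable_of_measurable_of_abs_le (C := 1) (hmeas l _) fun s => ?_).const_mul _
      rw [abs_of_nonneg measureReal_nonneg]
      exact measureReal_le_one
  simp only [hsuffix]
  exact sum_biasedWeight_sub_mul_integral_le (fun x => M.stateLaw (w ++ [x]))
    (fun x => inferInstance) (Real.one_le_exp hε) hδ hβ
    (fun x x' T hT => hM.stateLaw_le w (by rw [hw]; exact Finset.mem_range.1 ht) x x' hT)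
    V φ hφ hφ1

/-- A learner finds the planted parity. -/
lemma LearnsSignedParities.le_streamSum {k n : ℕ} {α : ℝ} (hM : LearnsSignedParities M k n α)
    (h0 : 0 ≤ 2 * α) (h1 : 2 * α ≤ 1) {l : Finset (Fin d)} (hl : l.card ≤ k) :
    99 / 100 ≤ streamSum (List.replicate n (biasedWeight (2 * α) l))
      (fun xs => (M.outputLaw xs).real {⟨l, 1⟩}) := by
  have hsub : {h : SignedParity d | ∀ g : SignedParity d, g.support.card ≤ k →
      h.err (biasedPMF h0 h1 l) < g.err (biasedPMF h0 h1 l) + α} ⊆ {⟨l, 1⟩} := fun h hh =>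
    eq_of_err_lt h0 h1 l h (hh ⟨l, 1⟩ hl)
  have h := (hM (biasedPMF h0 h1 l)).trans (Finset.sum_le_sum fun x _ =>
    mul_le_mul_right (measure_mono hsub) _)
  have h' := ENNReal.toReal_mono (ENNReal.sum_ne_top.2 fun x _ => ENNReal.mul_ne_top
    (ENNReal.prod_ne_top fun i _ => PMF.apply_ne_top _ _) (by finiteness)) h
  rw [ENNReal.toReal_sum fun x _ => ENNReal.mul_ne_top
    (ENNReal.prod_ne_top fun i _ => PMF.apply_ne_top _ _) (by finiteness)] at h'
  simp only [ENNReal.toReal_mul, ENNReal.toReal_prod, biasedPMF_toReal] at h'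
  rw [streamSum_replicate]
  simpa [measureReal_def] using h'

/-- On uniform samples the planted parity is unknown, so that the probabilities of finding it add up
to at most one. -/
lemma sum_streamSum_uniform_le (M : OnlineAlgorithm (LabelledPoint d) S (SignedParity d)) (n : ℕ)
    (V : Finset (Finset (Fin d))) :
    ∑ l ∈ V, streamSum (List.replicate n fun _ => 1 / 2 ^ (d + 1))
      (fun xs => (M.outputLaw xs).real {⟨l, 1⟩}) ≤ 1 := by
  refine sum_streamSum_replicate_le V n _ (fun _ => by positivity) ?_ _ _ fun xs _ => ?_
  · rw [Finset.sum_const, nsmul_eq_mul, Finset.card_univ, card_labelledPoint]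
    field_simp
  · refine (sum_measureReal_le_measureReal_univ (fun l _ => by trivial) ?_).trans measureReal_le_one
    intro l _ l' _ hne
    refine Set.disjoint_singleton.2 fun h => hne ?_
    exact congrArg SignedParity.support h

end Learning

/-! ### The sample complexity bound -/

lemma binomLe_add_one (d k : ℕ) :
    binomLe d k + 1 = (Finset.univ.filter fun l : Finset (Fin d) => l.card ≤ k).card := by
  have h : (Finset.univ.filter fun l : Finset (Fin d) => l.card ≤ k).card =
      ∑ j ∈ Finset.range (k + 1), d.choose j := by
    rw [Finset.card_eq_sum_card_fiberwise (f := Finset.card) (t := Finset.range (k + 1))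
      fun l hl => by simpa [Nat.lt_succ_iff] using hl]
    refine Finset.sum_congr rfl fun j hj => ?_
    have : (Finset.univ.filter fun l : Finset (Fin d) => l.card ≤ k).filter
        (fun l => l.card = j) = Finset.powersetCard j Finset.univ := by
      ext l
      have := Finset.mem_range.1 hj
      simp [Finset.mem_powersetCard]
      omega
    rw [this, Finset.card_powersetCard, Finset.card_univ, Fintype.card_fin]
  rw [h, Finset.sum_range_succ', binomLe, Nat.choose_zero_right, Finset.range_eq_Ico,
    Finset.sum_Ico_add' (fun j => d.choose j) 0 k 1]
  rfl

/-- The hypothesis on `δ` makes the contribution of `δ` negligible: since `N / δ ≥ 2`, the logarithm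
is at least `1 / 2`. -/
lemma delta_le {N α ε ε₀ δ : ℝ} (hN : 1 ≤ N) (hα : 0 < α) (hα' : α < 1 / 2) (hε : 0 < ε)
    (hε' : ε ≤ ε₀) (hδ : 0 ≤ δ) (hδ' : δ ≤ 1 / 2)
    (h : δ * Real.log (N / δ) ≤ 1 * (α ^ 2 * ε ^ 2 / N)) :
    2 * N * δ ≤ ε * ε₀ := by
  rcases hδ.eq_or_lt with rfl | hδ0
  · simpa using mul_nonneg hε.le (hε.le.trans hε')
  have hlog : 1 / 2 ≤ Real.log (N / δ) := by
    have : Real.log 2 ≤ Real.log (N / δ) := Real.log_le_log (by norm_num) (by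
      rw [le_div_iff₀ hδ0]; linarith)
    linarith [Real.log_two_gt_d9]
  have h1 : δ * (1 / 2) ≤ α ^ 2 * ε ^ 2 / N := by
    rw [one_mul] at h
    exact (mul_le_mul_of_nonneg_left hlog hδ).trans h
  rw [le_div_iff₀ (by linarith)] at h1
  have h2 : α ^ 2 ≤ 1 / 4 := by nlinarith
  have h3 : α ^ 2 * ε ^ 2 ≤ 1 / 4 * (ε * ε₀) :=
    mul_le_mul h2 (by rw [sq]; gcongr) (by positivity) (by norm_num)
  linarith

theorem mainTheorem2 (ε₀ : ℝ) (hε₀ : 0 < ε₀) :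
    ∃ c₁ : ℝ, 0 < c₁ ∧ ∃ c₂ : ℝ, 0 < c₂ ∧
      ∀ (d k n : ℕ) (α ε δ : ℝ),
        1 ≤ k → k ≤ d → 0 < α → α < 1 / 2 → 0 < ε → ε ≤ ε₀ → 0 ≤ δ → δ ≤ 1 / 2 →
        δ * Real.log ((binomLe d k : ℝ) / δ) ≤ c₁ * (α ^ 2 * ε ^ 2 / (binomLe d k : ℝ)) →
        ∀ (S : Type*) [MeasurableSpace S]
          (M : OnlineAlgorithm (LabelledPoint d) S (SignedParity d)),
          M.PanPrivate n ε δ → LearnsSignedParities M k n α →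
            c₂ * (Real.sqrt (binomLe d k : ℝ) / (α * ε)) ≤ (n : ℝ) := by
  set C := Real.exp ε₀ + ε₀ with hC
  have hC0 : 0 < C := by positivity
  refine ⟨1, one_pos, 1 / (10 * C), by positivity, ?_⟩
  intro d k n α ε δ hk hkd hα hα' hε hε' hδ hδ' hlog S _ M hpan hlearn
  set V := Finset.univ.filter fun l : Finset (Fin d) => l.card ≤ k
  have hVN : (V.card : ℝ) = binomLe d k + 1 := by exact_mod_cast (binomLe_add_one d k).symm
  have hN : (1 : ℝ) ≤ binomLe d k := by
    have : d.choose 1 ≤ binomLe d k :=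
      Finset.single_le_sum (f := fun j => d.choose j) (fun j _ => Nat.zero_le _) (by simp [hk])
    rw [Nat.choose_one_right] at this
    exact_mod_cast (hk.trans hkd).trans this
  have hδN := delta_le hN hα hα' hε hε' hδ hδ' hlog
  set N := (binomLe d k : ℝ)
  have hexp : Real.exp ε - 1 ≤ ε * Real.exp ε₀ := by
    -- `1 - ε ≤ exp (-ε)`, multiplied by `exp ε`.
    have h1 : (1 - ε) * Real.exp ε ≤ 1 := by
      calc (1 - ε) * Real.exp ε ≤ Real.exp (-ε) * Real.exp ε := by
            gcongr
            linarith [Real.add_one_le_exp (-ε)]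
        _ = 1 := by rw [← Real.exp_add]; simp
    have h2 : ε * Real.exp ε ≤ ε * Real.exp ε₀ := by gcongr
    linarith
  have hlow : (V.card : ℝ) * (99 / 100) ≤ ∑ l ∈ V,
      streamSum (List.replicate n (biasedWeight (2 * α) l))
        (fun xs => (M.outputLaw xs).real {⟨l, 1⟩}) := by
    rw [← nsmul_eq_mul]
    exact Finset.card_nsmul_le_sum _ _ _ fun l hl =>
      hlearn.le_streamSum (by linarith) (by linarith) (Finset.mem_filter.1 hl).2
  have hup := sum_streamSum_biased_le (β := 2 * α) hpan hε.le hδ (by linarith) (by linarith) V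
    fun l => {⟨l, 1⟩}
  have huni := sum_streamSum_uniform_le M n V
  have hmain := hlow.trans (hup.trans (add_le_add_left huni _))
  set r := √(V.card : ℝ)
  have hr0 : 0 ≤ r := Real.sqrt_nonneg _
  have hr2 : r ^ 2 = V.card := Real.sq_sqrt (by positivity)
  have hr1 : 1 ≤ r := by nlinarith
  -- Each of the two error terms of a step is at most a multiple of `ε * √|V|`.
  have hstep : (Real.exp ε - 1) * r + 2 * V.card * δ ≤ 2 * ε * C * r := by
    have h1 : (Real.exp ε - 1) * r ≤ ε * Real.exp ε₀ * r := by gcongr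
    have h2 : 2 * (V.card : ℝ) * δ ≤ 2 * (ε * ε₀) := by
      rw [hVN]; nlinarith
    have h3 : ε * ε₀ ≤ ε * ε₀ * r := le_mul_of_one_le_right (by positivity) hr1
    have h4 : 0 ≤ ε * Real.exp ε₀ * r := by positivity
    rw [hC]; nlinarith
  have hn : (0 : ℝ) ≤ n := Nat.cast_nonneg n
  have hbound : (n : ℝ) * (2 * α * ((Real.exp ε - 1) * r + 2 * V.card * δ)) ≤
      n * (2 * α * (2 * ε * C * r)) := by gcongr
  -- Since `|V| ≥ 2`, guessing without samples succeeds with probability at most `1 / 2`.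
  have hr : 12 / 25 * r ≤ n * (4 * (α * ε) * C) := by
    have : 12 / 25 * r * r ≤ n * (4 * (α * ε) * C) * r := by nlinarith
    exact le_of_mul_le_mul_right this (by linarith)
  have hNr : √N ≤ r := Real.sqrt_le_sqrt (by linarith)
  rw [div_mul_div_comm, one_mul, div_le_iff₀ (by positivity)]
  nlinarith
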